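/- Let $k$ be a field and let $\mathcal D$ be a nonzero, small, $k$-linear triangulated category with split idempotents which is Hom-finite, i.e. $\dim_k \operatorname{Hom}_{\mathcal D}(X,Y)<\infty$ for all objects $X,Y$. Call $\mathcal D$ \emph{locally finite} if for each indecomposable object $X$ there are only finitely many isomorphism classes of indecomposable objects $Y$ with $\operatorname{Hom}_{\mathcal D}(X,Y)\neq 0$. Let $Ab(\mathcal D)$ be the abelianisation of $\mathcal D$, i.e. the abelian category of all finitely presented functors: the additive functors $F:\mathcal D^{op}\to\mathrm{Ab}$ which admit an exact sequence $\operatorname{Hom}_{\mathcal D}(-,X)\to\operatorname{Hom}_{\mathcal D}(-,Y)\to F\to 0$ with $X,Y\in\mathcal D$. For an abelian category $\mathcal A$ put $\mathcal A_{-1}=0$ and, for $n\ge 0$, let $\mathcal A_n$ be the Serre subcategory of those objects which have finite length in the quotient category $\mathcal A/\mathcal A_{n-1}$. The Krull–Gabriel dimension $\operatorname{KGdim}\mathcal A$ is the smallest integer $n\geq -1$ with $\mathcal A=\mathcal A_n$, and $\infty$ if there is none. Then $\mathcal D$ is locally finite if and only if $\operatorname{KGdim}(Ab(\mathcal D))=0$.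 -/

import Mathlib

open CategoryTheory Limits

universe v u

noncomputable section

namespace KrullGabriel

/-! ### Objects of finite length -/

section FiniteLength

variable {A : Type u} [Category.{v} A]

/-- An object has finite length if its subobjects satisfy both chain conditions. In an abelian
category this is the same as having a composition series. -/
def finiteLength : ObjectProperty A := fun X =>
  IsNoetherianObject X ∧ IsArtinianObject X

lemma finiteLength_iff (X : A) :
    finiteLength X ↔ WellFoundedGT (Subobject X) ∧ WellFoundedLT (Subobject X) := by
  simp only [finiteLength, IsNoetherianObject, IsArtinianObject, ObjectProperty.is_iff]
  rfl

variable [Abelian A]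

/-- If `S ≤ T` are subobjects of `Y`, `e` is an epimorphism onto `T`, and the composite of `e` with
the inclusion of `T` factors through `S`, then `T ≤ S`. -/
lemma subobject_le_of_epi {Y E : A} {S T : Subobject Y} (e : E ⟶ (T : A)) [Epi e]
    (s : E ⟶ (S : A)) (h : e ≫ T.arrow = s ≫ S.arrow) : T ≤ S := by
  have h0 : T.arrow ≫ cokernel.π S.arrow = 0 := by
    rw [← cancel_epi e, ← Category.assoc, h, Category.assoc, cokernel.condition, comp_zero,
      comp_zero]
  have hk := Abelian.monoIsKernelOfCokernel _ (cokernelIsCokernel S.arrow)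
  refine Subobject.le_of_comm (hk.lift (KernelFork.ofι T.arrow h0)) ?_
  exact hk.fac (KernelFork.ofι T.arrow h0) WalkingParallelPair.zero

lemma strictMono_pullback_of_epi {Y Z : A} (p : Y ⟶ Z) [Epi p] :
    StrictMono (Subobject.pullback p).obj := by
  refine Monotone.strictMono_of_injective (Subobject.pullback p).monotone ?_
  have key : ∀ S T : Subobject Z, (Subobject.pullback p).obj T ≤ (Subobject.pullback p).obj S →
      T ≤ S := by
    intro S T h
    have sqT := Subobject.isPullback p T
    have sqS := Subobject.isPullback p S
    have : Epi (Subobject.pullbackπ p T) := Abelian.epi_fst_of_isLimit _ _ sqT.isLimit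
    refine subobject_le_of_epi (Subobject.pullbackπ p T)
      (Subobject.ofLE _ _ h ≫ Subobject.pullbackπ p S) ?_
    rw [sqT.w, Category.assoc, sqS.w, Subobject.ofLE_arrow_assoc]
  intro S T h
  exact le_antisymm (key _ _ (by rw [h])) (key _ _ (by rw [h]))

lemma strictMono_of_shortExact {S : ShortComplex A} (hS : S.ShortExact) :
    StrictMono (fun T : Subobject S.X₂ =>
      ((Subobject.pullback S.f).obj T, imageSubobject (T.arrow ≫ S.g))) := by
  have := hS.mono_f
  have hmono : Monotone (fun T : Subobject S.X₂ =>
      ((Subobject.pullback S.f).obj T, imageSubobject (T.arrow ≫ S.g))) := by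
    intro T₁ T₂ h
    refine ⟨(Subobject.pullback S.f).monotone h, ?_⟩
    have := imageSubobject_comp_le (Subobject.ofLE _ _ h) (T₂.arrow ≫ S.g)
    rwa [Subobject.ofLE_arrow_assoc] at this
  intro T₁ T₂ hlt
  refine lt_of_le_not_ge (hmono hlt.le) fun hge => hlt.not_ge ?_
  obtain ⟨hP, hI⟩ := hge
  dsimp only at hP hI
  -- lift `T₂ ⟶ image` through `T₁`, up to an epimorphism
  obtain ⟨E, e, he, s, hs⟩ := surjective_up_to_refinements_of_epi
    (factorThruImageSubobject (T₁.arrow ≫ S.g))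
    (factorThruImageSubobject (T₂.arrow ≫ S.g) ≫ Subobject.ofLE _ _ hI)
  have hs' : e ≫ T₂.arrow ≫ S.g = s ≫ T₁.arrow ≫ S.g := by
    have := congrArg (· ≫ (imageSubobject (T₁.arrow ≫ S.g)).arrow) hs
    simpa using this
  -- the difference comes from `X₁`
  let d : E ⟶ S.X₂ := e ≫ T₂.arrow - s ≫ T₁.arrow
  have hd : d ≫ S.g = 0 := by simp [d, hs']
  let a : E ⟶ S.X₁ := hS.exact.lift d hd
  have ha : a ≫ S.f = d := hS.exact.lift_f d hd
  have hd₂ : d = (e - s ≫ Subobject.ofLE _ _ hlt.le) ≫ T₂.arrow := by simp [d]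
  have sq₂ := Subobject.isPullback S.f T₂
  have sq₁ := Subobject.isPullback S.f T₁
  let l : E ⟶ ((Subobject.pullback S.f).obj T₂ : A) :=
    sq₂.lift (e - s ≫ Subobject.ofLE _ _ hlt.le) a (by rw [ha, hd₂])
  have hl : l ≫ ((Subobject.pullback S.f).obj T₂).arrow = a := sq₂.lift_snd _ _ _
  refine subobject_le_of_epi e
    (l ≫ Subobject.ofLE _ _ hP ≫ Subobject.pullbackπ S.f T₁ + s) ?_
  have : l ≫ Subobject.ofLE _ _ hP ≫ Subobject.pullbackπ S.f T₁ ≫ T₁.arrow = d := by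
    rw [sq₁.w, Subobject.ofLE_arrow_assoc, ← Category.assoc, hl, ha]
  simp only [Preadditive.add_comp, Category.assoc, this, d]
  abel

instance finiteLength_isSerreClass : (finiteLength (A := A)).IsSerreClass where
  exists_zero := by
    obtain ⟨Z, hZ⟩ := HasZeroObject.zero (C := A)
    exact ⟨Z, hZ, isNoetherianObject_of_isZero hZ, isArtinianObject_of_isZero hZ⟩
  prop_of_mono f _ h := by
    have := h.1
    have := h.2
    exact ⟨isNoetherianObject_of_mono f, isArtinianObject_of_mono f⟩
  prop_of_epi f _ h := by
    rw [finiteLength_iff] at h ⊢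
    have := h.1
    have := h.2
    exact ⟨(strictMono_pullback_of_epi f).wellFoundedGT,
      (strictMono_pullback_of_epi f).wellFoundedLT⟩
  prop_X₂_of_shortExact hS h₁ h₃ := by
    rw [finiteLength_iff] at h₁ h₃ ⊢
    have := h₁.1
    have := h₁.2
    have := h₃.1
    have := h₃.2
    exact ⟨(strictMono_of_shortExact hS).wellFoundedGT,
      (strictMono_of_shortExact hS).wellFoundedLT⟩

end FiniteLength

/-! ### The Krull–Gabriel filtration and dimension -/

section KGdim

variable (A : Type u) [Category.{v} A] [Abelian A]

/-- The Krull–Gabriel filtration of an abelian category, shifted by one: the `m`-th term is the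
Serre subcategory usually called `A_{m-1}`. One starts with `A_{-1} = 0`, and `A_n` consists of the
objects which have finite length in the quotient category `A / A_{n-1}`. -/
def kgFiltration : ℕ → {P : ObjectProperty A // P.IsSerreClass}
  | 0 => ⟨IsZero, inferInstance⟩
  | m + 1 =>
    let P := kgFiltration m
    letI := P.2
    ⟨finiteLength.inverseImage P.1.isoModSerre.Q, by
      let := ObjectProperty.SerreClassLocalization.abelian P.1.isoModSerre.Q P.1
      have := ObjectProperty.SerreClassLocalization.preservesFiniteLimits P.1.isoModSerre.Q P.1
      have := ObjectProperty.SerreClassLocalization.preservesFiniteColimits P.1.isoModSerre.Q P.1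
      infer_instance⟩

/-- The Krull–Gabriel dimension: the least `n ≥ -1` with `A = A_n`. The value `-1` (zero category)
is `⊥`, and the value is `⊤` when there is no such `n`. -/
def krullGabrielDim : WithBot ℕ∞ :=
  sInf {d | (d = ⊥ ∧ ∀ X : A, (kgFiltration A 0).1 X) ∨
    ∃ n : ℕ, d = ((n : ℕ∞) : WithBot ℕ∞) ∧ ∀ X : A, (kgFiltration A (n + 1)).1 X}

end KGdim

/-! ### Finitely presented functors and the abelianisation -/

section Abelianisation

open Opposite

section

variable (D : Type u) [Category.{v} D] [Preadditive D]

/-- The finitely presented functors: additive functors `F : Dᵒᵖ ⥤ Ab` for which there is an exact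
sequence `Hom(-, X) ⟶ Hom(-, Y) ⟶ F ⟶ 0`. -/
def finitelyPresented : ObjectProperty (Dᵒᵖ ⥤ AddCommGrpCat.{v}) := fun F =>
  F.Additive ∧ ∃ (X Y : D) (α : preadditiveYoneda.obj X ⟶ preadditiveYoneda.obj Y)
    (π : preadditiveYoneda.obj Y ⟶ F) (w : α ≫ π = 0),
    (ShortComplex.mk α π w).Exact ∧ Epi π

/-- The abelianisation: the full subcategory of finitely presented functors. -/
abbrev Abelianisation := (finitelyPresented D).FullSubcategory

variable {D}

lemma epi_app {C : Type*} [Category* C] {F G : C ⥤ AddCommGrpCat.{v}} (α : F ⟶ G) [Epi α] (T : C) :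
    Function.Surjective (α.app T) := by
  have : Epi (α.app T) := inferInstance
  exact (AddCommGrpCat.epi_iff_surjective _).1 this

lemma mono_app {C : Type*} [Category* C] {F G : C ⥤ AddCommGrpCat.{v}} (α : F ⟶ G) [Mono α]
    (T : C) : Function.Injective (α.app T) := by
  have : Mono (α.app T) := inferInstance
  exact (AddCommGrpCat.mono_iff_injective _).1 this

lemma exact_app {C : Type*} [Category* C] {S : ShortComplex (C ⥤ AddCommGrpCat.{v})} (hS : S.Exact)
    (T : C) (x : S.X₂.obj T) (hx : S.g.app T x = 0) : ∃ y, S.f.app T y = x :=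
  (ShortComplex.ab_exact_iff _).1 (hS.map ((evaluation C AddCommGrpCat.{v}).obj T)) x hx

lemma exact_of_app {C : Type*} [Category* C] {S : ShortComplex (C ⥤ AddCommGrpCat.{v})}
    (h : ∀ (T : C) (x : S.X₂.obj T), S.g.app T x = 0 → ∃ y, S.f.app T y = x) : S.Exact := by
  rw [S.exact_iff_isZero_homology]
  refine Functor.isZero _ fun T => ?_
  refine IsZero.of_iso ?_ (S.mapHomologyIso ((evaluation C AddCommGrpCat.{v}).obj T)).symm
  rw [← ShortComplex.exact_iff_isZero_homology, ShortComplex.ab_exact_iff]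
  exact h T

lemma nat_app {C : Type*} [Category* C] {F G : C ⥤ AddCommGrpCat.{v}} (α : F ⟶ G) {S T : C}
    (k : S ⟶ T) (z : F.obj S) : α.app T (F.map k z) = G.map k (α.app S z) :=
  ConcreteCategory.congr_hom (α.naturality k) z

lemma map_op_add (F : Dᵒᵖ ⥤ AddCommGrpCat.{v}) [F.Additive] {T Y : D} (a b : T ⟶ Y)
    (x : F.obj (op Y)) : F.map (a + b).op x = F.map a.op x + F.map b.op x := by
  rw [op_add, F.map_add]
  rfl

lemma map_op_sub (F : Dᵒᵖ ⥤ AddCommGrpCat.{v}) [F.Additive] {T Y : D} (a b : T ⟶ Y)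
    (x : F.obj (op Y)) : F.map (a - b).op x = F.map a.op x - F.map b.op x := by
  rw [eq_sub_iff_add_eq, ← map_op_add, sub_add_cancel]

lemma map_op_comp {D : Type u} [Category.{v} D] (F : Dᵒᵖ ⥤ AddCommGrpCat.{v}) {S T Y : D} (b : S ⟶ T) (a : T ⟶ Y)
    (x : F.obj (op Y)) : F.map (b ≫ a).op x = F.map b.op (F.map a.op x) := by
  rw [op_comp, F.map_comp]
  rfl

/-- Finite presentability in terms of a generator `x` of `F`, all of whose relations are generated
by one morphism `f`. -/
lemma finitelyPresented_iff (F : Dᵒᵖ ⥤ AddCommGrpCat.{v}) :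
    finitelyPresented D F ↔ F.Additive ∧ ∃ (X Y : D) (f : X ⟶ Y) (x : F.obj (op Y)),
      (∀ (T : D) (t : F.obj (op T)), ∃ a : T ⟶ Y, F.map a.op x = t) ∧
      (∀ (T : D) (a : T ⟶ Y), F.map a.op x = 0 ↔ ∃ b : T ⟶ X, b ≫ f = a) := by
  refine and_congr_right fun hF => ⟨?_, ?_⟩
  · rintro ⟨X, Y, α, π, w, hex, hπ⟩
    have hα : ∀ (T : D) (b : T ⟶ X), α.app (op T) b = b ≫ (show X ⟶ Y from α.app (op X) (𝟙 X)) := by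
      intro T b
      have := nat_app α b.op (𝟙 X)
      rwa [show (preadditiveYoneda.obj X).map b.op (𝟙 X) = b from Category.comp_id b] at this
    have hπa : ∀ (T : D) (a : T ⟶ Y), π.app (op T) a = F.map a.op (π.app (op Y) (𝟙 Y)) := by
      intro T a
      have := nat_app π a.op (𝟙 Y)
      rwa [show (preadditiveYoneda.obj Y).map a.op (𝟙 Y) = a from Category.comp_id a] at this
    refine ⟨X, Y, α.app (op X) (𝟙 X), π.app (op Y) (𝟙 Y), fun T t => ?_, fun T a => ?_⟩
    · obtain ⟨a, ha⟩ := epi_app π (op T) t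
      exact ⟨a, (hπa T a).symm.trans ha⟩
    · rw [← hπa]
      constructor
      · intro h
        obtain ⟨b, hb⟩ := exact_app hex (op T) a h
        exact ⟨b, (hα T b).symm.trans hb⟩
      · rintro ⟨b, rfl⟩
        rw [← hα]
        exact ConcreteCategory.congr_hom (NatTrans.congr_app w (op T)) b
  · rintro ⟨X, Y, f, x, h₁, h₂⟩
    let π : preadditiveYoneda.obj Y ⟶ F :=
      { app := fun T => AddCommGrpCat.ofHom (AddMonoidHom.mk'
          (fun (a : T.unop ⟶ Y) => (F.map a.op x : F.obj T)) fun a b => map_op_add F a b x)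
        naturality := by
          intro T T' g
          ext (a : T.unop ⟶ Y)
          change F.map (g.unop ≫ a).op x = F.map g (F.map a.op x)
          simp }
    have hπ : ∀ (T : Dᵒᵖ) (a : T.unop ⟶ Y), π.app T a = F.map a.op x := fun _ _ => rfl
    refine ⟨X, Y, preadditiveYoneda.map f, π, ?_, ?_, ?_⟩
    · ext T (b : T.unop ⟶ X)
      exact (h₂ T.unop (b ≫ f)).2 ⟨b, rfl⟩
    · refine exact_of_app fun T (a : T.unop ⟶ Y) ha => ?_
      exact (h₂ T.unop a).1 ha
    · rw [NatTrans.epi_iff_epi_app]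
      intro T
      rw [AddCommGrpCat.epi_iff_surjective]
      exact h₁ T.unop

lemma additive_of_epi {F G : Dᵒᵖ ⥤ AddCommGrpCat.{v}} (p : F ⟶ G) [Epi p] [F.Additive] :
    G.Additive where
  map_add {S T f g} := by
    ext y
    obtain ⟨y, rfl⟩ := epi_app p S y
    have e : ∀ u w : F.obj T, p.app T (u + w) = p.app T u + p.app T w := fun u w => map_add _ u w
    change G.map (f + g) (p.app S y) = G.map f (p.app S y) + G.map g (p.app S y)
    rw [← nat_app, ← nat_app, ← nat_app, ← e, F.map_add]
    rfl

lemma additive_of_mono {F G : Dᵒᵖ ⥤ AddCommGrpCat.{v}} (i : F ⟶ G) [Mono i] [G.Additive] :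
    F.Additive where
  map_add {S T f g} := by
    ext y
    apply mono_app i T
    have e : ∀ u w : F.obj T, i.app T (u + w) = i.app T u + i.app T w := fun u w => map_add _ u w
    change i.app T (F.map (f + g) y) = i.app T (F.map f y + F.map g y)
    rw [e, nat_app, nat_app, nat_app, G.map_add]
    rfl

lemma exists_weakPullback [HasBinaryBiproducts D] [HasWeakKernels D] {X Y Z : D} (f : X ⟶ Z)
    (g : Y ⟶ Z) : ∃ (W : D) (p : W ⟶ X) (q : W ⟶ Y), p ≫ f = q ≫ g ∧
      ∀ (T : D) (a : T ⟶ X) (b : T ⟶ Y), a ≫ f = b ≫ g → ∃ l : T ⟶ W, l ≫ p = a ∧ l ≫ q = b := by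
  refine ⟨weakKernel (biprod.desc f (-g)), weakKernel.ι _ ≫ biprod.fst,
    weakKernel.ι _ ≫ biprod.snd, ?_, fun T a b h => ?_⟩
  · have := weakKernel.condition (biprod.desc f (-g))
    have h : weakKernel.ι (biprod.desc f (-g)) ≫ biprod.desc f (-g) =
        weakKernel.ι (biprod.desc f (-g)) ≫ (biprod.fst ≫ f - biprod.snd ≫ g) := by
      congr 1
      rw [biprod.desc_eq, Preadditive.comp_neg, sub_eq_add_neg]
    rw [h, Preadditive.comp_sub, sub_eq_zero] at this
    simpa only [Category.assoc] using this
  · have h0 : biprod.lift a b ≫ biprod.desc f (-g) = 0 := by simp [h]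
    exact ⟨weakKernel.lift _ _ h0, by simp [← Category.assoc], by simp [← Category.assoc]⟩

end

section

variable {D : Type u} [Category.{v} D] [Preadditive D]

instance [HasZeroObject D] : (finitelyPresented D).ContainsZero where
  exists_zero := by
    obtain ⟨N, hN⟩ := HasZeroObject.zero (C := Dᵒᵖ ⥤ AddCommGrpCat.{v})
    refine ⟨N, hN, ?_⟩
    rw [finitelyPresented_iff]
    obtain ⟨Z, hZ⟩ := HasZeroObject.zero (C := D)
    have hs : ∀ T, Subsingleton (N.obj T) := fun T =>
      AddCommGrpCat.subsingleton_of_isZero (hN.obj T)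
    exact ⟨.of_isZero hN, Z, Z, 𝟙 Z, 0, fun T t => ⟨0, Subsingleton.elim _ _⟩,
      fun T a => ⟨fun _ => ⟨a, by simp⟩, fun _ => Subsingleton.elim _ _⟩⟩

variable [HasBinaryBiproducts D]

instance : (finitelyPresented D).IsClosedUnderCokernels where
  cokernels_le := by
    rintro _ @⟨F, G, φ, c, hc, hF, hG⟩
    rw [finitelyPresented_iff] at hF hG ⊢
    obtain ⟨hFa, XF, YF, f, x, hx₁, hx₂⟩ := hF
    obtain ⟨hGa, XG, YG, g, y, hy₁, hy₂⟩ := hG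
    have : Epi c.π := Cofork.IsColimit.epi hc
    refine ⟨additive_of_epi c.π, ?_⟩
    have hex := (ShortComplex.mk φ c.π c.condition).exact_of_g_is_cokernel
      (hc.ofIsoColimit (Cofork.ext (Iso.refl _)))
    have hzero : ∀ (T : D) z, c.π.app (op T) (φ.app (op T) z) = 0 := fun T z =>
      ConcreteCategory.congr_hom (NatTrans.congr_app c.condition (op T)) z
    obtain ⟨e, he⟩ := hy₁ YF (φ.app _ x)
    refine ⟨YF ⊞ XG, YG, biprod.desc e g, c.π.app _ y, fun T t => ?_, fun T a => ?_⟩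
    · obtain ⟨t, rfl⟩ := epi_app c.π _ t
      obtain ⟨a, rfl⟩ := hy₁ T t
      exact ⟨a, (nat_app _ _ _).symm⟩
    · rw [← nat_app]
      constructor
      · intro h
        obtain ⟨s, hs⟩ := exact_app hex (op T) _ h
        obtain ⟨k, rfl⟩ := hx₁ T s
        have h0 : G.map (a - k ≫ e).op y = 0 := by
          rw [map_op_sub, map_op_comp, he, ← nat_app, sub_eq_zero]
          exact hs.symm
        obtain ⟨b, hb⟩ := (hy₂ _ _).1 h0
        exact ⟨biprod.lift k b, by rw [biprod.lift_desc, hb]; abel⟩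
      · rintro ⟨b, rfl⟩
        have : b ≫ biprod.desc e g = (b ≫ biprod.fst) ≫ e + (b ≫ biprod.snd) ≫ g := by
          rw [biprod.desc_eq]; simp
        rw [this, map_op_add, (hy₂ _ ((b ≫ biprod.snd) ≫ g)).2 ⟨_, rfl⟩, add_zero, map_op_comp, he,
          ← nat_app]
        exact hzero _ _

instance [HasWeakKernels D] : (finitelyPresented D).IsClosedUnderKernels where
  kernels_le := by
    rintro _ @⟨F, G, φ, c, hc, hF, hG⟩
    rw [finitelyPresented_iff] at hF hG ⊢
    obtain ⟨hFa, XF, YF, f, x, hx₁, hx₂⟩ := hF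
    obtain ⟨hGa, XG, YG, g, y, hy₁, hy₂⟩ := hG
    have : Mono c.ι := Fork.IsLimit.mono hc
    refine ⟨additive_of_mono c.ι, ?_⟩
    have hex := (ShortComplex.mk c.ι φ c.condition).exact_of_f_is_kernel
      (hc.ofIsoLimit (Fork.ext (Iso.refl _)))
    have hzero : ∀ (T : D) z, φ.app (op T) (c.ι.app (op T) z) = 0 := fun T z =>
      ConcreteCategory.congr_hom (NatTrans.congr_app c.condition (op T)) z
    obtain ⟨e, he⟩ := hy₁ YF (φ.app _ x)
    -- weak pullbacks
    obtain ⟨W, p, q, hpq, hW⟩ := exists_weakPullback e g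
    obtain ⟨V, r, s, hrs, hV⟩ := exists_weakPullback p f
    obtain ⟨z, hz⟩ := exact_app hex (op W) (F.map p.op x) (by
      refine (nat_app φ p.op x).trans ?_
      rw [← he, ← map_op_comp, hy₂]
      exact ⟨q, hpq.symm⟩)
    have hz' : ∀ (T : D) (a : T ⟶ W), c.ι.app (op T) (c.pt.map a.op z) = F.map (a ≫ p).op x := by
      intro T a
      rw [map_op_comp]
      exact (nat_app c.ι a.op z).trans (congrArg _ hz)
    refine ⟨V, W, r, z, fun T t => ?_, fun T a => ?_⟩
    · obtain ⟨k, hk⟩ := hx₁ T (c.ι.app _ t)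
      have : G.map (k ≫ e).op y = 0 := by
        rw [map_op_comp, he, ← nat_app, hk]
        exact hzero _ _
      obtain ⟨b, hb⟩ := (hy₂ _ _).1 this
      obtain ⟨a, ha, -⟩ := hW T k b hb.symm
      exact ⟨a, mono_app c.ι _ (by rw [hz', ha, hk])⟩
    · have : c.pt.map a.op z = 0 ↔ F.map (a ≫ p).op x = 0 := by
        rw [← hz', map_eq_zero_iff _ (mono_app c.ι (op T))]
      rw [this, hx₂]
      constructor
      · rintro ⟨b, hb⟩
        obtain ⟨l, hl, -⟩ := hV T a b hb.symm
        exact ⟨l, hl⟩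
      · rintro ⟨l, rfl⟩
        exact ⟨l ≫ s, by rw [Category.assoc, Category.assoc, hrs]⟩

instance : (finitelyPresented D).IsClosedUnderIsomorphisms where
  of_iso {F G} i hF := by
    obtain ⟨h, X, Y, α, π, w, hex, hπ⟩ := hF
    refine ⟨additive_of_epi i.hom, X, Y, α, π ≫ i.hom, by rw [reassoc_of% w, zero_comp], ?_,
      inferInstance⟩
    exact (ShortComplex.exact_iff_of_iso (ShortComplex.isoMk (S₁ := .mk α π w)
      (S₂ := .mk α (π ≫ i.hom) (by rw [reassoc_of% w, zero_comp]))
      (Iso.refl _) (Iso.refl _) i)).1 hex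

lemma finitelyPresented_biprod {F G : Dᵒᵖ ⥤ AddCommGrpCat.{v}} (hF : finitelyPresented D F)
    (hG : finitelyPresented D G) : finitelyPresented D (F ⊞ G) := by
  rw [finitelyPresented_iff] at hF hG ⊢
  obtain ⟨hFa, XF, YF, f, x, hx₁, hx₂⟩ := hF
  obtain ⟨hGa, XG, YG, g, y, hy₁, hy₂⟩ := hG
  let B : Dᵒᵖ ⥤ AddCommGrpCat.{v} := F ⊞ G
  let i₁ : F ⟶ B := biprod.inl
  let i₂ : G ⟶ B := biprod.inr
  let p₁ : B ⟶ F := biprod.fst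
  let p₂ : B ⟶ G := biprod.snd
  have h₁₁ : ∀ T (u : F.obj T), p₁.app T (i₁.app T u) = u := fun T u =>
    ConcreteCategory.congr_hom (NatTrans.congr_app (biprod.inl_fst (X := F) (Y := G)) T) u
  have h₁₂ : ∀ T (u : F.obj T), p₂.app T (i₁.app T u) = 0 := fun T u =>
    ConcreteCategory.congr_hom (NatTrans.congr_app (biprod.inl_snd (X := F) (Y := G)) T) u
  have h₂₁ : ∀ T (u : G.obj T), p₁.app T (i₂.app T u) = 0 := fun T u =>
    ConcreteCategory.congr_hom (NatTrans.congr_app (biprod.inr_fst (X := F) (Y := G)) T) u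
  have h₂₂ : ∀ T (u : G.obj T), p₂.app T (i₂.app T u) = u := fun T u =>
    ConcreteCategory.congr_hom (NatTrans.congr_app (biprod.inr_snd (X := F) (Y := G)) T) u
  have htot : ∀ T (u : B.obj T), i₁.app T (p₁.app T u) + i₂.app T (p₂.app T u) = u := fun T u =>
    ConcreteCategory.congr_hom (NatTrans.congr_app (biprod.total (X := F) (Y := G)) T) u
  have hB : B.Additive :=
    { map_add := fun {S T k l} => by
        ext u
        have e₁ : ∀ u w : F.obj T, i₁.app T (u + w) = i₁.app T u + i₁.app T w :=
          fun u w => map_add _ u w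
        have e₂ : ∀ u w : G.obj T, i₂.app T (u + w) = i₂.app T u + i₂.app T w :=
          fun u w => map_add _ u w
        change B.map (k + l) u = B.map k u + B.map l u
        rw [← htot T (B.map (k + l) u), ← htot T (B.map k u), ← htot T (B.map l u)]
        simp only [nat_app p₁, nat_app p₂]
        rw [F.map_add, G.map_add]
        change i₁.app T (F.map k _ + F.map l _) + i₂.app T (G.map k _ + G.map l _) = _
        rw [e₁, e₂]
        abel }
  let z : B.obj (op (YF ⊞ YG)) :=
    i₁.app _ (F.map (biprod.fst : YF ⊞ YG ⟶ YF).op x) +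
      i₂.app _ (G.map (biprod.snd : YF ⊞ YG ⟶ YG).op y)
  have hz : ∀ (T : D) (a : T ⟶ YF ⊞ YG), B.map a.op z =
      i₁.app _ (F.map (a ≫ biprod.fst).op x) + i₂.app _ (G.map (a ≫ biprod.snd).op y) := by
    intro T a
    rw [map_op_comp, map_op_comp, nat_app i₁ a.op, nat_app i₂ a.op]
    exact (B.map a.op).hom.map_add _ _
  refine ⟨hB, XF ⊞ XG, YF ⊞ YG, biprod.map f g, z, fun T t => ?_, fun T a => ?_⟩
  · obtain ⟨a, ha⟩ := hx₁ T (p₁.app _ t)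
    obtain ⟨b, hb⟩ := hy₁ T (p₂.app _ t)
    refine ⟨biprod.lift a b, (hz _ _).trans ?_⟩
    rw [biprod.lift_fst, biprod.lift_snd, ha, hb]
    exact htot _ t
  · have : B.map a.op z = 0 ↔
        F.map (a ≫ biprod.fst).op x = 0 ∧ G.map (a ≫ biprod.snd).op y = 0 := by
      rw [hz]
      constructor
      · intro h
        have hp₁ := congrArg (p₁.app (op T)) h
        have hp₂ := congrArg (p₂.app (op T)) h
        rw [map_add, map_zero, h₁₁, h₂₁, add_zero] at hp₁
        rw [map_add, map_zero, h₁₂, h₂₂, zero_add] at hp₂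
        exact ⟨hp₁, hp₂⟩
      · rintro ⟨h, h'⟩
        rw [h, h', map_zero, map_zero, add_zero]
    refine this.trans ?_
    rw [hx₂, hy₂]
    constructor
    · rintro ⟨⟨b, hb⟩, c, hc⟩
      refine ⟨biprod.lift b c, ?_⟩
      ext <;> simp [hb, hc]
    · rintro ⟨b, rfl⟩
      exact ⟨⟨b ≫ biprod.fst, by simp⟩, b ≫ biprod.snd, by simp⟩

instance [HasZeroObject D] : (finitelyPresented D).IsClosedUnderFiniteProducts := by
  have : (finitelyPresented D).IsClosedUnderBinaryProducts := ⟨by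
    rintro F ⟨p⟩
    have i := p.isLimit.conePointsIsoOfNatIso
      (BinaryBiproduct.isLimit (p.diag.obj ⟨.left⟩) (p.diag.obj ⟨.right⟩)) (diagramIsoPair _)
    exact (finitelyPresented D).prop_of_iso i.symm
      (finitelyPresented_biprod (p.prop_diag_obj _) (p.prop_diag_obj _))⟩
  exact ObjectProperty.IsClosedUnderFiniteProducts.mk'

end

/-- The abelianisation of a triangulated category is abelian. -/
instance abelianisationAbelian (D : Type u) [Category.{v} D] [Preadditive D] [HasZeroObject D]
    [HasShift D ℤ] [∀ n : ℤ, (shiftFunctor D n).Additive] [Pretriangulated D] :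
    Abelian (Abelianisation D) :=
  inferInstance

end Abelianisation

/-! ### Locally finite triangulated categories -/

/-- `D` is locally finite if for each indecomposable object `X` there are only finitely many
isomorphism classes of indecomposable objects `Y` with `Hom(X, Y) ≠ 0`. (The notion is used for
Hom-finite categories `D`.) -/
def IsLocallyFinite (D : Type u) [Category.{v} D] [Preadditive D] [HasBinaryBiproducts D] : Prop :=
  ∀ X : D, Indecomposable X →
    Set.Finite {c : Quotient (isIsomorphicSetoid D) |
      ∃ Y : D, c = Quotient.mk _ Y ∧ Indecomposable Y ∧ ∃ f : X ⟶ Y, f ≠ 0}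

end KrullGabriel

end

noncomputable section

namespace KrullGabriel

/-! ### Preorders of morphisms into and out of an object -/

section Factor

variable {C : Type u} [Category.{v} C]

/-- The morphisms into `X`, preordered by factorisation: `f ≤ g` if `f` factors through `g`. -/
structure FactorOver (X : C) where
  /-- the source -/
  {left : C}
  /-- the morphism -/
  hom : left ⟶ X

/-- The morphisms out of `X`, preordered by factorisation: `f ≤ g` if `f` factors through `g`. -/
structure FactorUnder (X : C) where
  /-- the target -/
  {right : C}
  /-- the morphism -/
  hom : X ⟶ right

instance (X : C) : Preorder (FactorOver X) where
  le f g := ∃ h, h ≫ g.hom = f.hom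
  le_refl f := ⟨𝟙 _, by simp⟩
  le_trans := by
    rintro f g l ⟨a, ha⟩ ⟨b, hb⟩
    exact ⟨a ≫ b, by rw [Category.assoc, hb, ha]⟩

instance (X : C) : Preorder (FactorUnder X) where
  le f g := ∃ h, g.hom ≫ h = f.hom
  le_refl f := ⟨𝟙 _, by simp⟩
  le_trans := by
    rintro f g l ⟨a, ha⟩ ⟨b, hb⟩
    exact ⟨b ≫ a, by rw [← Category.assoc, hb, ha]⟩

lemma FactorUnder.le_iff {X : C} (f g : FactorUnder X) : f ≤ g ↔ ∃ h, g.hom ≫ h = f.hom := Iff.rfl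

end Factor

/-- A preorder satisfying both chain conditions. -/
def BiWellFounded (α : Type*) [Preorder α] : Prop := WellFoundedGT α ∧ WellFoundedLT α

lemma BiWellFounded.of_le_iff {α β : Type*} [Preorder α] [Preorder β] (h : BiWellFounded β)
    (φ : α → β) (hφ : ∀ a b, φ a ≤ φ b ↔ a ≤ b) : BiWellFounded α := by
  have hs : StrictMono φ := fun a b hab => by
    rw [lt_iff_le_not_ge, hφ, hφ, ← lt_iff_le_not_ge]
    exact hab
  have := h.1
  have := h.2
  exact ⟨hs.wellFoundedGT, hs.wellFoundedLT⟩

lemma BiWellFounded.dual {α : Type*} [Preorder α] (h : BiWellFounded α) :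
    BiWellFounded αᵒᵈ := by
  have := h.1
  have := h.2
  exact ⟨inferInstance, inferInstance⟩

section Triangulated

open Pretriangulated

variable {D : Type u} [Category.{v} D] [Preadditive D] [HasZeroObject D] [HasShift D ℤ]
    [∀ n : ℤ, (shiftFunctor D n).Additive] [Pretriangulated D]

lemma factorOver_iff_factorUnder {X Y Y' Z Z' : D} {f : Y ⟶ X} {g : X ⟶ Z} {h : Z ⟶ Y⟦(1 : ℤ)⟧}
    (T : Triangle.mk f g h ∈ distTriang D) {f' : Y' ⟶ X} {g' : X ⟶ Z'} {h' : Z' ⟶ Y'⟦(1 : ℤ)⟧}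
    (T' : Triangle.mk f' g' h' ∈ distTriang D) :
    (∃ a, a ≫ f' = f) ↔ ∃ b, g ≫ b = g' := by
  have w : f ≫ g = 0 := comp_distTriang_mor_zero₁₂ _ T
  have w' : f' ≫ g' = 0 := comp_distTriang_mor_zero₁₂ _ T'
  constructor
  · rintro ⟨a, rfl⟩
    obtain ⟨b, hb⟩ := Triangle.yoneda_exact₂ _ T g' (by
      change (a ≫ f') ≫ g' = 0
      rw [Category.assoc, w', comp_zero])
    exact ⟨b, hb.symm⟩
  · rintro ⟨b, rfl⟩
    obtain ⟨a, ha⟩ := Triangle.coyoneda_exact₂ _ T' f (by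
      change f ≫ g ≫ b = 0
      rw [reassoc_of% w, zero_comp])
    exact ⟨a, ha.symm⟩

lemma biWellFounded_factorOver_iff_factorUnder (X : D) :
    BiWellFounded (FactorOver X) ↔ BiWellFounded (FactorUnder X) := by
  constructor
  · intro H
    choose Y f h T using fun g : FactorUnder X => distinguished_cocone_triangle₁ g.hom
    exact H.dual.of_le_iff (fun g => OrderDual.toDual ⟨f g⟩)
      fun a b => factorOver_iff_factorUnder (T b) (T a)
  · intro H
    choose Z g h T using fun f : FactorOver X => distinguished_cocone_triangle f.hom
    exact H.dual.of_le_iff (fun f => OrderDual.toDual ⟨g f⟩)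
      fun a b => (factorOver_iff_factorUnder (T a) (T b)).symm

end Triangulated

/-! ### Indecomposable objects in Hom-finite categories -/

section Indecomposable

lemma isUnit_or_isNilpotent_of_isIdempotentElem (k : Type*) {R : Type*} [Field k] [Ring R]
    [Algebra k R] [FiniteDimensional k R] (h : ∀ e : R, IsIdempotentElem e → e = 0 ∨ e = 1)
    (r : R) : IsUnit r ∨ IsNilpotent r := by
  let S := Algebra.adjoin k {r}
  have : IsMulCommutative S := Algebra.isMulCommutative_adjoin k (by simp)
  have : FiniteDimensional k S := inferInstanceAs (FiniteDimensional k S.toSubmodule)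
  have : IsArtinianRing S := IsArtinianRing.of_finite k S
  let s : S := ⟨r, Algebra.subset_adjoin rfl⟩
  obtain ⟨n, y, hy⟩ := IsArtinian.exists_pow_succ_smul_dvd s (1 : S)
  simp only [smul_eq_mul, mul_one] at hy
  have key : ∀ m, s ^ n = s ^ (n + m) * y ^ m := by
    intro m
    induction m with
    | zero => simp
    | succ m ih =>
      calc s ^ n = s ^ n * s ^ m * y ^ m := by rw [← pow_add]; exact ih
        _ = (s ^ (n + 1) * y) * s ^ m * y ^ m := by rw [hy]
        _ = s ^ (n + (m + 1)) * y ^ (m + 1) := by ring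
  have hpow : s ^ (n + 1) = s ^ (n + 1) * (s ^ (n + 1) * y ^ (n + 1)) := by
    calc s ^ (n + 1) = s ^ n * s := pow_succ _ _
      _ = s ^ (n + (n + 1)) * y ^ (n + 1) * s := by rw [← key]
      _ = _ := by ring
  have he : IsIdempotentElem (s ^ (n + 1) * y ^ (n + 1)) := by
    calc s ^ (n + 1) * y ^ (n + 1) * (s ^ (n + 1) * y ^ (n + 1))
        = s ^ (n + 1) * (s ^ (n + 1) * y ^ (n + 1)) * y ^ (n + 1) := by ring
      _ = _ := by rw [← hpow]
  have hcomm : ∀ a b : S, (a : R) * b = b * a := fun a b => congrArg Subtype.val (mul_comm a b)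
  rcases h _ (congrArg Subtype.val he : ((s ^ (n + 1) * y ^ (n + 1) : S) : R) * _ = _) with h0 | h1
  · right
    refine ⟨n + 1, ?_⟩
    have h0' : s ^ (n + 1) * y ^ (n + 1) = 0 := Subtype.ext h0
    rw [h0', mul_zero] at hpow
    exact congrArg Subtype.val hpow
  · left
    have h1' : s * (s ^ n * y ^ (n + 1)) = 1 := by
      rw [← mul_assoc, ← pow_succ']
      exact Subtype.ext h1
    have h2 := congrArg Subtype.val h1'
    have h3 := congrArg Subtype.val ((mul_comm _ _).trans h1')
    exact ⟨⟨r, _, h2, h3⟩, rfl⟩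

variable {D : Type u} [Category.{v} D] [Preadditive D]

/-- The subspace of `X ⟶ T` of all morphisms which factor through `a`. -/
def FactorUnder.submodule (k : Type*) [Field k] [Linear k D] {X : D} (a : FactorUnder X) (T : D) :
    Submodule k (X ⟶ T) :=
  LinearMap.range (Linear.leftComp k T a.hom)

lemma FactorUnder.mem_submodule (k : Type*) [Field k] [Linear k D] {X : D} (a : FactorUnder X)
    {T : D} (f : X ⟶ T) : f ∈ a.submodule k T ↔ FactorUnder.mk f ≤ a := by
  simp [FactorUnder.submodule, FactorUnder.le_iff]

variable [HasBinaryBiproducts D]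

lemma Indecomposable.eq_zero_or_eq_id [IsIdempotentComplete D] {Y : D}
    (hY : Indecomposable Y) (e : Y ⟶ Y) (he : e ≫ e = e) : e = 0 ∨ e = 𝟙 Y := by
  obtain ⟨Z, i, p, hip, hpi⟩ := IsIdempotentComplete.idempotents_split Y e he
  obtain ⟨Z', i', p', hip', hpi'⟩ := IsIdempotentComplete.idempotents_split Y (𝟙 Y - e)
    (Idempotents.idem_of_id_sub_idem e he)
  have : IsSplitMono i := ⟨⟨p, hip⟩⟩
  have : IsSplitEpi p := ⟨⟨i, hip⟩⟩
  have : IsSplitMono i' := ⟨⟨p', hip'⟩⟩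
  have : IsSplitEpi p' := ⟨⟨i', hip'⟩⟩
  have h₁ : i ≫ p' = 0 := by
    rw [← cancel_epi p, ← cancel_mono i']
    simp only [Category.assoc, hpi', reassoc_of% hpi]
    simp [he]
  have h₂ : i' ≫ p = 0 := by
    rw [← cancel_epi p', ← cancel_mono i]
    simp only [Category.assoc, hpi, reassoc_of% hpi']
    simp [he]
  let φ : Y ≅ Z ⊞ Z' :=
    { hom := biprod.lift p p'
      inv := biprod.desc i i'
      hom_inv_id := by simp [hpi, hpi']
      inv_hom_id := by ext <;> simp [hip, hip', h₁, h₂] }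
  rcases hY.2 _ _ φ with h | h
  · left
    rw [← hpi, h.eq_of_tgt p 0, zero_comp]
  · right
    rw [h.eq_of_tgt p' 0, zero_comp] at hpi'
    exact (sub_eq_zero.1 hpi'.symm).symm

lemma Indecomposable.isIso_or_isIso_id_sub (k : Type*) [Field k] [Linear k D]
    [IsIdempotentComplete D] {Y : D} [FiniteDimensional k (Y ⟶ Y)]
    (hY : Indecomposable Y) (f : Y ⟶ Y) : IsIso f ∨ IsIso (𝟙 Y - f) := by
  have : FiniteDimensional k (End Y) := inferInstanceAs (FiniteDimensional k (Y ⟶ Y))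
  have := isUnit_or_isNilpotent_of_isIdempotentElem k (R := End Y)
    (fun e he => Indecomposable.eq_zero_or_eq_id hY e he) f
  rcases this with h | h
  · exact Or.inl ((isUnit_iff_isIso f).1 h)
  · exact Or.inr ((isUnit_iff_isIso (𝟙 Y - f)).1 h.isUnit_one_sub)

lemma Indecomposable.isIso_of_isSplitMono [IsIdempotentComplete D] {Y Z : D}
    (hY : Indecomposable Y) (hZ : Indecomposable Z) (f : Y ⟶ Z) [IsSplitMono f] : IsIso f := by
  have hf : f ≫ retraction f = 𝟙 Y := IsSplitMono.id f
  rcases Indecomposable.eq_zero_or_eq_id hZ (retraction f ≫ f)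
    (by rw [Category.assoc, reassoc_of% hf]) with h | h
  · refine absurd ?_ hY.1
    rw [IsZero.iff_id_eq_zero]
    calc 𝟙 Y = f ≫ (retraction f ≫ f) ≫ retraction f := by simp
      _ = 0 := by rw [h]; simp
  · exact ⟨retraction f, hf, h⟩

/-- Every property of objects which holds for zero and indecomposable objects and is stable under
biproducts holds for all objects of a Hom-finite category. -/
lemma indecomposable_induction (k : Type*) [Field k] [Linear k D]
    (homFinite : ∀ X Y : D, FiniteDimensional k (X ⟶ Y)) (P : D → Prop)
    (zero : ∀ X, IsZero X → P X) (indec : ∀ X, Indecomposable X → P X)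
    (sum : ∀ X Y Z : D, (X ≅ Y ⊞ Z) → P Y → P Z → P X) (X : D) : P X := by
  induction hn : Module.finrank k (X ⟶ X) using Nat.strong_induction_on generalizing X with
  | _ n ih =>
    by_cases hX : IsZero X
    · exact zero X hX
    by_cases hX' : Indecomposable X
    · exact indec X hX'
    have : ∃ Y Z : D, Nonempty (X ≅ Y ⊞ Z) ∧ ¬ IsZero Y ∧ ¬ IsZero Z := by
      by_contra! h
      exact hX' ⟨hX, fun Y Z e => or_iff_not_imp_left.2 (h Y Z ⟨e⟩)⟩
    obtain ⟨Y, Z, ⟨e⟩, hY, hZ⟩ := this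
    have pos : ∀ W : D, ¬ IsZero W → 0 < Module.finrank k (W ⟶ W) := by
      intro W hW
      rw [Module.finrank_pos_iff_exists_ne_zero]
      exact ⟨𝟙 W, fun h => hW ((IsZero.iff_id_eq_zero W).2 h)⟩
    let φ : ((Y ⟶ Y) × (Z ⟶ Z)) →ₗ[k] (X ⟶ X) :=
      { toFun := fun p => e.hom ≫ biprod.map p.1 p.2 ≫ e.inv
        map_add' := fun p q => by
          rw [← Preadditive.comp_add, ← Preadditive.add_comp]
          congr 2
          ext <;> simp
        map_smul' := fun c p => by
          rw [RingHom.id_apply, ← Linear.comp_smul, ← Linear.smul_comp]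
          congr 2
          ext <;> simp }
    have hφ : Function.Injective φ := by
      intro p q h
      have h' : e.hom ≫ biprod.map p.1 p.2 ≫ e.inv = e.hom ≫ biprod.map q.1 q.2 ≫ e.inv := h
      rw [cancel_epi, cancel_mono] at h'
      have h₁ := congrArg (fun t => biprod.inl ≫ t ≫ biprod.fst) h'
      have h₂ := congrArg (fun t => biprod.inr ≫ t ≫ biprod.snd) h'
      simp only [biprod.map_fst, biprod.inl_fst_assoc] at h₁
      simp only [biprod.map_snd, biprod.inr_snd_assoc] at h₂
      exact Prod.ext h₁ h₂
    have hle := LinearMap.finrank_le_finrank_of_injective hφ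
    rw [Module.finrank_prod] at hle
    have hY' := pos Y hY
    have hZ' := pos Z hZ
    exact sum X Y Z e (ih _ (by omega) Y rfl) (ih _ (by omega) Z rfl)

/-- The isomorphism classes of the indecomposable objects `Y` for which there is a nonzero
morphism `X ⟶ Y` factoring through `a`. -/
def indecomposableClasses {X : D} (a : FactorUnder X) : Set (Quotient (isIsomorphicSetoid D)) :=
  {c | ∃ Y : D, c = Quotient.mk _ Y ∧ Indecomposable Y ∧ ∃ h : a.right ⟶ Y, a.hom ≫ h ≠ 0}

lemma isLocallyFinite_iff :
    IsLocallyFinite D ↔ ∀ X : D, Indecomposable X → (indecomposableClasses ⟨𝟙 X⟩).Finite := by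
  simp [IsLocallyFinite, indecomposableClasses]

/-- If `b` is a maximal element below `a`, then at most one indecomposable object `Y` has a
morphism `X ⟶ Y` which factors through `a` but not through `b`. -/
lemma nonempty_iso_of_covBy (k : Type*) [Field k] [Linear k D] [IsIdempotentComplete D]
    (homFinite : ∀ X Y : D, FiniteDimensional k (X ⟶ Y)) {X : D} {a b : FactorUnder X}
    (hab : a ⋖ b) {Y Y' : D} (hY : Indecomposable Y) (hY' : Indecomposable Y') (f : X ⟶ Y)
    (f' : X ⟶ Y') (hf : FactorUnder.mk f ≤ b) (hf' : FactorUnder.mk f' ≤ b)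
    (hfa : ¬ FactorUnder.mk f ≤ a) (hfa' : ¬ FactorUnder.mk f' ≤ a) : Nonempty (Y ≅ Y') := by
  have key : ∀ {Z W : D} (g : X ⟶ Z) (g' : X ⟶ W), FactorUnder.mk g ≤ b →
      ¬ FactorUnder.mk g ≤ a → FactorUnder.mk g' ≤ b →
      ∃ (u : a.right ⟶ W) (v : Z ⟶ W), a.hom ≫ u + g ≫ v = g' := by
    rintro Z W g g' ⟨l, hl⟩ hga hg'
    obtain ⟨m, hm⟩ := hab.1.le
    let c : FactorUnder X := ⟨biprod.lift a.hom g⟩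
    have hac : a ≤ c := ⟨biprod.fst, by simp [c]⟩
    have hgc : FactorUnder.mk g ≤ c := ⟨biprod.snd, by simp [c]⟩
    have hcb : c ≤ b := ⟨biprod.lift m l, by ext <;> simp [c, hm, hl]⟩
    have hac' : a < c := lt_of_le_not_ge hac fun h => hga (hgc.trans h)
    have hbc : b ≤ c := by
      by_contra h
      exact hab.2 hac' (lt_of_le_not_ge hcb h)
    obtain ⟨w, hw⟩ := hg'.trans hbc
    refine ⟨biprod.inl ≫ w, biprod.inr ≫ w, ?_⟩
    have hc : biprod.lift a.hom g = a.hom ≫ biprod.inl + g ≫ biprod.inr := by ext <;> simp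
    change biprod.lift a.hom g ≫ w = g' at hw
    rw [← hw, hc, Preadditive.add_comp, Category.assoc, Category.assoc]
  obtain ⟨u, v, h⟩ := key f f' hf hfa hf'
  obtain ⟨u', v', h'⟩ := key f' f hf' hfa' hf
  have hvv : f ≫ (𝟙 Y - v ≫ v') = a.hom ≫ (u ≫ v' + u') := by
    have : f = a.hom ≫ u' + (a.hom ≫ u + f ≫ v) ≫ v' := by rw [h, h']
    rw [Preadditive.comp_sub, Category.comp_id, sub_eq_iff_eq_add]
    nth_rw 1 [this]
    simp only [Preadditive.comp_add, Preadditive.add_comp, Category.assoc]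
    abel
  have := homFinite Y Y
  rcases Indecomposable.isIso_or_isIso_id_sub k hY (v ≫ v') with hi | hi
  · have : IsSplitMono v := ⟨⟨v' ≫ inv (v ≫ v'), by rw [← Category.assoc, IsIso.hom_inv_id]⟩⟩
    have := Indecomposable.isIso_of_isSplitMono hY hY' v
    exact ⟨asIso v⟩
  · refine absurd ⟨(u ≫ v' + u') ≫ inv (𝟙 Y - v ≫ v'), ?_⟩ hfa
    rw [← Category.assoc, ← hvv, Category.assoc, IsIso.hom_inv_id, Category.comp_id]

lemma finite_indecomposableClasses (k : Type*) [Field k] [Linear k D] [IsIdempotentComplete D]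
    (homFinite : ∀ X Y : D, FiniteDimensional k (X ⟶ Y)) {X : D}
    (hX : BiWellFounded (FactorUnder X)) (b : FactorUnder X) :
    (indecomposableClasses b).Finite := by
  obtain ⟨_, _⟩ := hX
  induction b using WellFoundedLT.induction with
  | _ b ih =>
    let z : FactorUnder X := ⟨(0 : X ⟶ X)⟩
    have hzb : z ≤ b := ⟨0, by simp [z]⟩
    by_cases hbz : b ≤ z
    · convert Set.finite_empty
      refine Set.eq_empty_iff_forall_notMem.2 ?_
      rintro _ ⟨Y, rfl, hY, h, hh⟩
      obtain ⟨l, hl⟩ := hbz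
      exact hh (by rw [← hl]; simp [z])
    obtain ⟨a, hab⟩ : ∃ a, a ⋖ b := by
      obtain ⟨a, ha, hmax⟩ := (wellFounded_gt (α := FactorUnder X)).has_min {a | a < b}
        ⟨z, lt_of_le_not_ge hzb hbz⟩
      exact ⟨a, ha, fun c hac hcb => hmax c hcb hac⟩
    have hsub : Set.Subsingleton (indecomposableClasses b \ indecomposableClasses a) := by
      have hle : ∀ {Y : D} (hY : Indecomposable Y) (h : b.right ⟶ Y) (h0 : b.hom ≫ h ≠ 0),
          Quotient.mk (isIsomorphicSetoid D) Y ∉ indecomposableClasses a →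
          ¬ FactorUnder.mk (b.hom ≫ h) ≤ a := by
        rintro Y hY h h0 hn ⟨l, hl⟩
        exact hn ⟨Y, rfl, hY, l, by rwa [hl]⟩
      rintro _ ⟨⟨Y, rfl, hY, h, h0⟩, hn⟩ _ ⟨⟨Y', rfl, hY', h', h0'⟩, hn'⟩
      exact Quotient.sound (nonempty_iso_of_covBy k homFinite hab hY hY' _ _ ⟨h, rfl⟩ ⟨h', rfl⟩
        (hle hY h h0 hn) (hle hY' h' h0' hn'))
    exact ((ih a hab.1).union hsub.finite).subset fun c hc => by
      by_cases h : c ∈ indecomposableClasses a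
      · exact Or.inl h
      · exact Or.inr ⟨hc, h⟩

lemma finite_indecomposableClasses_of_isLocallyFinite (k : Type*) [Field k] [Linear k D]
    (homFinite : ∀ X Y : D, FiniteDimensional k (X ⟶ Y)) (hD : IsLocallyFinite D) (X : D) :
    (indecomposableClasses (FactorUnder.mk (𝟙 X))).Finite := by
  refine indecomposable_induction k homFinite _ (fun X hX => ?_) (isLocallyFinite_iff.1 hD)
    (fun X Y Z e hY hZ => ?_) X
  · convert Set.finite_empty
    refine Set.eq_empty_iff_forall_notMem.2 ?_
    rintro _ ⟨Y, rfl, hY, h, hh⟩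
    exact hh (hX.eq_of_src _ _)
  · refine (hY.union hZ).subset ?_
    rintro _ ⟨T, rfl, hT, (h : X ⟶ T), hh⟩
    simp only [Category.id_comp] at hh
    by_cases h₁ : biprod.inl ≫ e.inv ≫ h = 0
    · refine Or.inr ⟨T, rfl, hT, biprod.inr ≫ e.inv ≫ h, fun h₂ => hh ?_⟩
      rw [Category.id_comp] at h₂
      rw [← cancel_epi e.inv, comp_zero]
      ext <;> simp [h₁, h₂]
    · exact Or.inl ⟨T, rfl, hT, biprod.inl ≫ e.inv ≫ h, by rwa [Category.id_comp]⟩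

lemma biWellFounded_factorUnder_of_finite (k : Type*) [Field k] [Linear k D]
    (homFinite : ∀ X Y : D, FiniteDimensional k (X ⟶ Y)) {X : D}
    (hX : (indecomposableClasses (FactorUnder.mk (𝟙 X))).Finite) :
    BiWellFounded (FactorUnder X) := by
  let I := indecomposableClasses (FactorUnder.mk (𝟙 X))
  have : Finite I := hX
  let Φ (a : FactorUnder X) (i : I) : Submodule k (X ⟶ i.1.out) := a.submodule k i.1.out
  have : BiWellFounded ((i : I) → Submodule k (X ⟶ i.1.out)) := by
    have := Pi.wellFoundedLT (ι := I) (α := fun i => Submodule k (X ⟶ i.1.out))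
    have h' := Pi.wellFoundedLT (ι := I) (α := fun i => (Submodule k (X ⟶ i.1.out))ᵒᵈ)
    refine ⟨⟨h'.wf⟩, this⟩
  refine this.of_le_iff Φ fun a b => ⟨fun hab => ?_, fun hab i f hf => ?_⟩
  · have key : ∀ (T : D) (f : X ⟶ T), FactorUnder.mk f ≤ a → FactorUnder.mk f ≤ b := by
      intro T
      refine indecomposable_induction k homFinite
        (fun T => ∀ f : X ⟶ T, FactorUnder.mk f ≤ a → FactorUnder.mk f ≤ b)
        (fun T hT f _ => ⟨0, hT.eq_of_tgt _ _⟩) (fun T hT f hf => ?_)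
        (fun T Y Z e hY hZ f hf => ?_) T
      · by_cases h0 : f = 0
        · exact ⟨0, by simp [h0]⟩
        let i : I := ⟨Quotient.mk _ T, T, rfl, hT, f, by simpa using h0⟩
        obtain ⟨e⟩ : Nonempty (i.1.out ≅ T) := Quotient.exact i.1.out_eq
        have h₁ : FactorUnder.mk (f ≫ e.inv) ≤ a := le_trans ⟨e.inv, rfl⟩ hf
        have h₂ := (b.mem_submodule k _).1 (hab i ((a.mem_submodule k _).2 h₁))
        exact le_trans ⟨e.hom, by simp⟩ h₂
      · obtain ⟨g, hg⟩ := hY (f ≫ e.hom ≫ biprod.fst) (le_trans ⟨_, rfl⟩ hf)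
        obtain ⟨h, hh⟩ := hZ (f ≫ e.hom ≫ biprod.snd) (le_trans ⟨_, rfl⟩ hf)
        refine ⟨biprod.lift g h ≫ e.inv, ?_⟩
        rw [← Category.assoc, Iso.comp_inv_eq]
        ext <;> simp [hg, hh]
    exact key _ a.hom le_rfl
  · exact (b.mem_submodule k f).2 (((a.mem_submodule k f).1 hf).trans hab)

/-- A Hom-finite idempotent complete category is locally finite if and only if, for each object
`X`, the finitely generated subfunctors of `Hom(X, -)` satisfy both chain conditions. -/
theorem isLocallyFinite_iff_biWellFounded_factorUnder (k : Type*) [Field k] [Linear k D]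
    [IsIdempotentComplete D] (homFinite : ∀ X Y : D, FiniteDimensional k (X ⟶ Y)) :
    IsLocallyFinite D ↔ ∀ X : D, BiWellFounded (FactorUnder X) :=
  ⟨fun h X => biWellFounded_factorUnder_of_finite k homFinite
      (finite_indecomposableClasses_of_isLocallyFinite k homFinite h X),
    fun h => isLocallyFinite_iff.2 fun X _ => finite_indecomposableClasses k homFinite (h X) _⟩

end Indecomposable

/-! ### Objects of finite length and Krull–Gabriel dimension zero -/

section FiniteLength

lemma finiteLength_iff_biWellFounded {A : Type*} [Category* A] (X : A) :
    finiteLength X ↔ BiWellFounded (Subobject X) :=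
  finiteLength_iff X

lemma finiteLength_of_map {A B : Type*} [Category* A] [Category* B] (F : A ⥤ B) [F.Full]
    [F.Faithful] [F.PreservesMonomorphisms] {X : A} (h : finiteLength (F.obj X)) :
    finiteLength X := by
  rw [finiteLength_iff_biWellFounded] at h ⊢
  refine h.of_le_iff (fun S => Subobject.mk (F.map S.arrow)) fun S T =>
    ⟨fun hST => ?_, fun hST => ?_⟩
  · refine Subobject.le_of_comm (F.preimage (Subobject.ofMkLEMk _ _ hST)) (F.map_injective ?_)
    simp
  · exact Subobject.mk_le_mk_of_comm (F.map (Subobject.ofLE _ _ hST))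
      (by rw [← F.map_comp, Subobject.ofLE_arrow])

lemma finiteLength_map_iff {A B : Type*} [Category* A] [Abelian A] [Category* B] (F : A ⥤ B)
    [F.IsEquivalence] (X : A) : finiteLength (F.obj X) ↔ finiteLength X := by
  refine ⟨finiteLength_of_map F, fun h => finiteLength_of_map F.inv ?_⟩
  exact finiteLength.prop_of_iso (F.asEquivalence.unitIso.app X) h

variable {A : Type u} [Category.{v} A] [Abelian A]

lemma kgFiltration_one_iff (X : A) : (kgFiltration A 1).1 X ↔ finiteLength X := by
  let P : ObjectProperty A := IsZero
  have : P.IsSerreClass := (kgFiltration A 0).2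
  have hP : P.isoModSerre ≤ MorphismProperty.isomorphisms A := by
    intro Y Z f hf
    obtain ⟨hm, he⟩ := (P.isoModSerre_iff f).1 hf
    have : Mono f := Preadditive.mono_of_isZero_kernel f hm
    have : Epi f := Preadditive.epi_of_isZero_cokernel f he
    exact isIso_of_mono_of_epi f
  have : P.isoModSerre.Q.IsEquivalence := by
    have : (𝟭 A).IsLocalization P.isoModSerre := Functor.IsLocalization.for_id _ hP
    exact Functor.isEquivalence_of_iso
      ((Functor.leftUnitor _).symm ≪≫
        Localization.compUniqFunctor (𝟭 A) P.isoModSerre.Q P.isoModSerre)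
  exact finiteLength_map_iff P.isoModSerre.Q X

variable (A) in
lemma krullGabrielDim_eq_zero_iff (hA : ∃ X : A, ¬ IsZero X) :
    krullGabrielDim A = 0 ↔ ∀ X : A, finiteLength X := by
  have hbot : ¬ ∀ X : A, (kgFiltration A 0).1 X := by
    intro h
    obtain ⟨X, hX⟩ := hA
    exact hX (h X)
  have hle : 0 ≤ krullGabrielDim A := by
    refine le_sInf ?_
    rintro d (⟨-, h⟩ | ⟨n, rfl, -⟩)
    · exact absurd h hbot
    · exact_mod_cast (zero_le : 0 ≤ (n : ℕ∞))
  constructor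
  · intro h X
    by_contra hX
    have : (1 : WithBot ℕ∞) ≤ krullGabrielDim A := by
      refine le_sInf ?_
      rintro d (⟨-, h⟩ | ⟨n, rfl, hn⟩)
      · exact absurd h hbot
      · cases n with
        | zero => exact absurd ((kgFiltration_one_iff X).1 (hn X)) hX
        | succ n => exact_mod_cast Nat.succ_le_succ (Nat.zero_le n)
    rw [h] at this
    exact absurd this (by decide)
  · intro h
    refine le_antisymm (sInf_le (Or.inr ⟨0, rfl, fun X => (kgFiltration_one_iff X).2 (h X)⟩)) hle

/-- If every object of the abelian category `A` is a quotient of some `H.obj Y`, where `H` is fully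
faithful with projective values, then the subobjects of `H.obj X` are the images of the morphisms
`H.map f`. -/
lemma biWellFounded_subobject_iff {D : Type*} [Category* D] (H : D ⥤ A) [H.Full] [H.Faithful]
    (hH : ∀ X, Projective (H.obj X)) (hA : ∀ F : A, ∃ (Y : D) (p : H.obj Y ⟶ F), Epi p) (X : D) :
    BiWellFounded (Subobject (H.obj X)) ↔ BiWellFounded (FactorOver X) := by
  let φ (f : FactorOver X) : Subobject (H.obj X) := imageSubobject (H.map f.hom)
  have hφ : ∀ f g, φ f ≤ φ g ↔ f ≤ g := by
    intro f g
    constructor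
    · intro h
      let a : H.obj f.left ⟶ H.obj g.left := Projective.factorThru
        (factorThruImageSubobject (H.map f.hom) ≫ Subobject.ofLE _ _ h)
        (factorThruImageSubobject (H.map g.hom))
      refine ⟨H.preimage a, H.map_injective ?_⟩
      have ha : a ≫ factorThruImageSubobject (H.map g.hom) = _ := Projective.factorThru_comp _ _
      have := congrArg (· ≫ (imageSubobject (H.map g.hom)).arrow) ha
      simpa [φ] using this
    · rintro ⟨a, ha⟩
      simp only [φ, ← ha, H.map_comp]
      exact imageSubobject_comp_le _ _
  have hsurj : ∀ S, ∃ f, φ f = S := by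
    intro S
    obtain ⟨Y, p, hp⟩ := hA (S : A)
    refine ⟨⟨H.preimage (p ≫ S.arrow)⟩, ?_⟩
    simp only [φ, H.map_preimage]
    exact le_antisymm (imageSubobject_le _ p rfl)
      (subobject_le_of_epi p (factorThruImageSubobject (p ≫ S.arrow)) (by simp))
  constructor
  · intro h
    exact h.of_le_iff φ hφ
  · intro h
    choose s hs using hsurj
    exact h.of_le_iff s fun S T => by rw [← hφ, hs, hs]

end FiniteLength

/-! ### Representable functors in the abelianisation -/

section Representable

open Opposite

variable {D : Type u} [Category.{v} D] [Preadditive D]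

lemma abelianisation_hom_app_surjective [HasBinaryBiproducts D] {F G : Abelianisation D}
    (p : F ⟶ G) [Epi p] (T : Dᵒᵖ) : Function.Surjective (p.hom.app T) := by
  have hC : finitelyPresented D (cokernel p.hom) :=
    (finitelyPresented D).prop_cokernel p.hom F.2 G.2
  let q : G ⟶ ⟨cokernel p.hom, hC⟩ := ObjectProperty.homMk (cokernel.π p.hom)
  have hq : q = 0 := by
    rw [← cancel_epi p, comp_zero]
    ext1
    exact cokernel.condition p.hom
  have : Epi p.hom := Preadditive.epi_of_isZero_cokernel _ (by
    rw [IsZero.iff_id_eq_zero, ← cancel_epi (cokernel.π p.hom), comp_zero, Category.comp_id]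
    exact congrArg (fun t => t.hom) hq)
  exact epi_app p.hom T

variable [HasZeroObject D]

lemma finitelyPresented_preadditiveYoneda (X : D) :
    finitelyPresented D (preadditiveYoneda.obj X) := by
  rw [finitelyPresented_iff]
  obtain ⟨Z, hZ⟩ := HasZeroObject.zero (C := D)
  refine ⟨inferInstance, Z, X, 0, 𝟙 X, fun T t => ⟨t, Category.comp_id (show T ⟶ X from t)⟩,
    fun T a => ?_⟩
  change a ≫ 𝟙 X = 0 ↔ _
  rw [Category.comp_id]
  exact ⟨fun h => ⟨0, by simp [h]⟩, fun ⟨b, hb⟩ => by rw [← hb, comp_zero]⟩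

variable (D) in
/-- The Yoneda embedding of `D` into its abelianisation. -/
def abelianisationYoneda : D ⥤ Abelianisation D :=
  (finitelyPresented D).lift preadditiveYoneda finitelyPresented_preadditiveYoneda

instance : (abelianisationYoneda D).Full :=
  inferInstanceAs ((finitelyPresented D).lift _ _).Full

instance : (abelianisationYoneda D).Faithful :=
  inferInstanceAs ((finitelyPresented D).lift _ _).Faithful

lemma abelianisationYoneda_projective [HasBinaryBiproducts D] (X : D) :
    Projective ((abelianisationYoneda D).obj X) where
  factors {F G} f p _ := by
    obtain ⟨x, hx⟩ := abelianisation_hom_app_surjective p (op X)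
      (f.hom.app (op X) (𝟙 X : X ⟶ X))
    have := F.2.1
    let φ : preadditiveYoneda.obj X ⟶ F.obj :=
      { app := fun T => AddCommGrpCat.ofHom (AddMonoidHom.mk'
          (fun (a : T.unop ⟶ X) => (F.obj.map a.op x : F.obj.obj T))
            fun a b => map_op_add F.obj a b x)
        naturality := by
          intro T T' g
          ext (a : T.unop ⟶ X)
          change F.obj.map (g.unop ≫ a).op x = F.obj.map g (F.obj.map a.op x)
          simp }
    refine ⟨ObjectProperty.homMk φ, ?_⟩
    ext T (a : T.unop ⟶ X)
    change p.hom.app T (F.obj.map a.op x) = f.hom.app T a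
    rw [nat_app, hx]
    refine (nat_app f.hom a.op _).symm.trans (congrArg (f.hom.app T) ?_)
    exact Category.comp_id a

lemma exists_epi_abelianisationYoneda (F : Abelianisation D) :
    ∃ (Y : D) (p : (abelianisationYoneda D).obj Y ⟶ F), Epi p := by
  obtain ⟨-, X, Y, α, π, w, -, hπ⟩ := F.2
  let p : (abelianisationYoneda D).obj Y ⟶ F := ObjectProperty.homMk π
  exact ⟨Y, p, (finitelyPresented D).ι.epi_of_epi_map (f := p) hπ⟩

end Representable

end KrullGabriel

end

theorem mainTheorem7 (k : Type*) [Field k]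
    (D : Type u) [Category.{v} D] [Preadditive D] [HasZeroObject D] [HasShift D ℤ]
    [∀ n : ℤ, (shiftFunctor D n).Additive] [Pretriangulated D] [IsTriangulated D]
    [Linear k D] (homFinite : ∀ X Y : D, FiniteDimensional k (X ⟶ Y))
    [IsIdempotentComplete D] (nonzero : ∃ X : D, ¬ IsZero X) :
    KrullGabriel.IsLocallyFinite D ↔
      KrullGabriel.krullGabrielDim (KrullGabriel.Abelianisation D) = 0 := by
  have hA : ∃ F : KrullGabriel.Abelianisation D, ¬ IsZero F := by
    obtain ⟨X, hX⟩ := nonzero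
    refine ⟨(KrullGabriel.abelianisationYoneda D).obj X, fun h => hX ?_⟩
    rw [IsZero.iff_id_eq_zero]
    apply (KrullGabriel.abelianisationYoneda D).map_injective
    exact h.eq_of_src _ _
  have hiff : ∀ X : D, KrullGabriel.finiteLength ((KrullGabriel.abelianisationYoneda D).obj X) ↔
      KrullGabriel.BiWellFounded (KrullGabriel.FactorUnder X) := fun X => by
    rw [KrullGabriel.finiteLength_iff_biWellFounded, KrullGabriel.biWellFounded_subobject_iff _
      KrullGabriel.abelianisationYoneda_projective KrullGabriel.exists_epi_abelianisationYoneda,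
      KrullGabriel.biWellFounded_factorOver_iff_factorUnder]
  rw [KrullGabriel.krullGabrielDim_eq_zero_iff _ hA,
    KrullGabriel.isLocallyFinite_iff_biWellFounded_factorUnder k homFinite]
  constructor
  · intro h F
    obtain ⟨Y, p, hp⟩ := KrullGabriel.exists_epi_abelianisationYoneda F
    exact KrullGabriel.finiteLength.prop_of_epi p ((hiff Y).2 (h Y))
  · exact fun h X => (hiff X).1 (h _)
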